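/- **Theorem.** Let $\mathfrak R$ be a complete, separated topological associative (unital) ring, let $R$ be an associative ring, and let $\theta\colon R\to\mathfrak R$ be a ring homomorphism with dense image. Assume that $\mathfrak R$ has a countable base of neighborhoods of zero consisting of open two-sided ideals, each of which, viewed as a right ideal, is strongly generated by a finite set of elements lying in $\theta(R)$. Then the forgetful functor $\mathfrak R\text{-contra}\to R\text{-mod}$ from left $\mathfrak R$-contramodules to left $R$-modules is fully faithful. Here the following terminology is used. A family $(r_x)_{x\in X}$ of elements of $\mathfrak R$ *converges to zero* if every neighborhood of zero contains all but finitely many of the $r_x$. A finite set of elements $s_1,\dots,s_m$ of a right ideal $\mathfrak J\subset\mathfrak R$ *strongly generates* $\mathfrak J$ if for every family $(r_x)_{x\in X}$ of elements of $\mathfrak J$ converging to zero in $\mathfrak R$ there are families $(r_{j,x})_{x\in X}$ in $\mathfrak R$, $j=1,\dots,m$, each converging to zero, such that $r_x=\sum_{j=1}^m s_j r_{j,x}$ for all $x\in X$. For a set $X$, let $\mathfrak R[[X]]$ be the set of formal linear combinations $\sum_{x\in X}r_x x$ whose coefficients $r_x\in\mathfrak R$ converge to zero. Then $X\mapsto\mathfrak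 R[[X]]$ is a monad on the category of sets: a map $f\colon X\to Y$ sends $\sum_x r_x x$ to $\sum_{y}\bigl(\sum_{f(x)=y}r_x\bigr)y$, the unit sends $x$ to $1\cdot x$, and the multiplication $\mathfrak R[[\mathfrak R[[X]]]]\to\mathfrak R[[X]]$ opens the parentheses, the infinite sums of coefficients being the limits of finite partial sums in $\mathfrak R$. *Left $\mathfrak R$-contramodules* are the modules (Eilenberg–Moore algebras) over this monad. The *forgetful functor* equips a contramodule $C$ with structure map $\pi\colon\mathfrak R[[C]]\to C$ with the left $R$-module structure $c+d=\pi(1\cdot c+1\cdot d)$, $r c=\pi(\theta(r)\cdot c)$, and leaves the underlying maps of morphisms unchanged. -/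

import Mathlib

open CategoryTheory Filter Topology

universe u v w

noncomputable section

set_option linter.unusedSectionVars false

/-! Throughout, `K` is a complete, separated topological associative ring in which the open
right ideals form a base of neighborhoods of zero.  The last condition is spelled
`IsLinearTopology Kᵐᵒᵖ K` (a right ideal is a submodule over the opposite ring). -/

/-- The set `K[[X]]` of all infinite formal linear combinations `∑ r_x x` of elements of `X`
with the family of coefficients `r_x` in `K` converging to zero: every neighborhood of zero
contains all but finitely many of the `r_x`. -/
structure FormalComb (K : Type u) [Ring K] [TopologicalSpace K] (X : Type w) :
    Type (max u w) where
  /-- The family of coefficients. -/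
  coeff : X → K
  tendsto : Tendsto coeff cofinite (𝓝 0)

namespace FormalComb

section Algebraic

variable {K : Type u} [Ring K] [TopologicalSpace K] [IsTopologicalRing K] {X : Type w}

instance : CoeFun (FormalComb K X) (fun _ => X → K) := ⟨coeff⟩

@[ext]
theorem ext {r t : FormalComb K X} (h : ∀ x, r x = t x) : r = t := by
  cases r
  cases t
  congr 1
  exact funext h

instance : Zero (FormalComb K X) := ⟨⟨fun _ => 0, tendsto_const_nhds⟩⟩

instance : Add (FormalComb K X) :=
  ⟨fun r t => ⟨fun x => r x + t x, by simpa using r.tendsto.add t.tendsto⟩⟩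

instance : Neg (FormalComb K X) :=
  ⟨fun r => ⟨fun x => - r x, by simpa using r.tendsto.neg⟩⟩

instance : SMul K (FormalComb K X) :=
  ⟨fun k r => ⟨fun x => k * r x, by simpa using r.tendsto.const_mul k⟩⟩

@[simp] theorem zero_apply (x : X) : (0 : FormalComb K X) x = 0 := rfl
@[simp] theorem add_apply (r t : FormalComb K X) (x : X) : (r + t) x = r x + t x := rfl
@[simp] theorem neg_apply (r : FormalComb K X) (x : X) : (-r) x = - r x := rfl
@[simp] theorem smul_apply (k : K) (r : FormalComb K X) (x : X) : (k • r) x = k * r x := rfl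

open Classical in
/-- The element `x` of `X` as a formal linear combination: coefficient `1` at `x`,
and `0` elsewhere. -/
def pure (K : Type u) [Ring K] [TopologicalSpace K] {X : Type w} (x : X) : FormalComb K X :=
  ⟨fun y => if y = x then 1 else 0, by
    refine tendsto_const_nhds.congr' ?_
    have : ({x}ᶜ : Set X) ∈ cofinite := (Set.finite_singleton x).compl_mem_cofinite
    filter_upwards [this] with y hy
    rw [if_neg (by simpa using hy)]⟩

end Algebraic

section Infinite

variable {K : Type u} [Ring K] [UniformSpace K] [IsUniformAddGroup K] [IsTopologicalRing K]
  [IsLinearTopology Kᵐᵒᵖ K]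

theorem hasBasis_open : (𝓝 (0 : K)).HasBasis
    (fun J : Submodule Kᵐᵒᵖ K => IsOpen (J : Set K)) (fun J => (J : Set K)) :=
  IsLinearTopology.hasBasis_open_submodule Kᵐᵒᵖ

theorem mul_mem_right {J : Submodule Kᵐᵒᵖ K} {a : K} (ha : a ∈ J) (b : K) : a * b ∈ J := by
  simpa using J.smul_mem (MulOpposite.op b) ha

theorem tendsto_zero_iff {X : Type w} {r : X → K} : Tendsto r cofinite (𝓝 0) ↔
    ∀ J : Submodule Kᵐᵒᵖ K, IsOpen (J : Set K) → {x | r x ∉ J}.Finite := by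
  rw [hasBasis_open.tendsto_right_iff]
  rfl

theorem tsum_mem {X : Type w} {r : X → K} {J : Submodule Kᵐᵒᵖ K} (hJ : IsOpen (J : Set K))
    (h : ∀ x, r x ∈ J) : ∑' x, r x ∈ J := by
  by_cases hs : Summable r
  · have hc : IsClosed (J : Set K) := AddSubgroup.isClosed_of_isOpen J.toAddSubgroup hJ
    exact hc.mem_of_tendsto hs.hasSum (Eventually.of_forall fun s => J.sum_mem fun x _ => h x)
  · rw [tsum_eq_zero_of_not_summable hs]; exact J.zero_mem

theorem summable [CompleteSpace K] {X : Type w} {r : X → K} (hr : Tendsto r cofinite (𝓝 0)) :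
    Summable r := by
  have : NonarchimedeanAddGroup K :=
    { is_nonarchimedean := fun U hU => by
        obtain ⟨J, hJ, hJU⟩ := hasBasis_open.mem_iff.1 hU
        exact ⟨⟨J.toAddSubgroup, hJ⟩, hJU⟩ }
  exact NonarchimedeanAddGroup.summable_of_tendsto_cofinite_zero hr

theorem tendsto_double {X : Type v} {Y : Type w} (r : FormalComb K X) (t : X → FormalComb K Y) :
    Tendsto (fun p : X × Y => r p.1 * t p.1 p.2) cofinite (𝓝 0) := by
  rw [tendsto_zero_iff]
  intro J hJ
  have hF := tendsto_zero_iff.1 r.2 J hJ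
  have hG : ∀ x, {y | r x * t x y ∉ J}.Finite := fun x =>
    tendsto_zero_iff.1 (r x • t x).2 J hJ
  refine (hF.biUnion fun x _ => (hG x).image fun y => (x, y)).subset ?_
  rintro ⟨x, y⟩ hxy
  simp only [Set.mem_iUnion, Set.mem_image]
  exact ⟨x, fun hx => hxy (mul_mem_right hx _), y, hxy, rfl⟩

theorem tendsto_mul_right {X : Type w} {r : X → K} (hr : Tendsto r cofinite (𝓝 0)) (t : X → K) :
    Tendsto (fun x => r x * t x) cofinite (𝓝 0) :=
  IsLinearTopology.tendsto_mul_zero_of_left r t hr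

/-- The map `K[[f]] : K[[X]] → K[[Y]]` induced by a map of sets `f : X → Y`; its coefficient at
`y` is the (unconditionally convergent) sum of the coefficients over the fiber of `f`. -/
def map {X : Type v} {Y : Type w} (f : X → Y) (r : FormalComb K X) : FormalComb K Y :=
  ⟨fun y => ∑' x : {x : X // f x = y}, r x.1, by
    rw [tendsto_zero_iff]
    intro J hJ
    refine ((tendsto_zero_iff.1 r.2 J hJ).image f).subset ?_
    intro y hy
    by_contra hcon
    refine hy (tsum_mem hJ ?_)
    rintro ⟨x, rfl⟩
    by_contra hx
    exact hcon ⟨x, hx, rfl⟩⟩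

/-- The sum `∑_x r_x t_x` of an `X`-indexed family `t_x` in `K[[Y]]` with the coefficients `r_x`,
computed coefficientwise. -/
def bind {X : Type v} {Y : Type w} (r : FormalComb K X) (t : X → FormalComb K Y) :
    FormalComb K Y :=
  ⟨fun y => ∑' x, r x * t x y, by
    rw [tendsto_zero_iff]
    intro J hJ
    refine ((tendsto_zero_iff.1 (tendsto_double r t) J hJ).image Prod.snd).subset ?_
    intro y hy
    by_contra hcon
    refine hy (tsum_mem hJ fun x => ?_)
    by_contra hx
    exact hcon ⟨(x, y), hx, rfl⟩⟩

/-- The map `K[[K[[X]]]] → K[[X]]` opening the parentheses: the coefficient of `∑_t r_t t`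
at `x` is `∑_t r_t t_x`. -/
def join {X : Type w} (r : FormalComb K (FormalComb K X)) : FormalComb K X :=
  ⟨fun x => ∑' t : FormalComb K X, r t * t x, (bind r id).2⟩

theorem join_eq_bind {X : Type w} (r : FormalComb K (FormalComb K X)) : join r = bind r id := rfl

theorem map_eq_bind {X : Type v} {Y : Type w} (f : X → Y) (r : FormalComb K X) :
    map f r = bind r (fun x => pure K (f x)) := by
  classical
  ext y
  change ∑' x : {x : X // f x = y}, r x.1 = ∑' x, r x * (if y = f x then 1 else 0)
  refine (tsum_subtype {x : X | f x = y} (fun x => r x)).trans ?_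
  refine tsum_congr fun x => ?_
  by_cases h : f x = y
  · rw [Set.indicator_of_mem (by exact h), if_pos h.symm, mul_one]
  · rw [Set.indicator_of_notMem (by exact h), if_neg (Ne.symm h), mul_zero]

variable [T2Space K]

theorem pure_bind {X : Type v} {Y : Type w} (x : X) (t : X → FormalComb K Y) :
    bind (pure K x) t = t x := by
  classical
  ext y
  change ∑' x', (if x' = x then 1 else 0) * t x' y = t x y
  rw [tsum_eq_single x (fun x' hx' => by rw [if_neg hx', zero_mul]), if_pos rfl, one_mul]

theorem bind_pure {X : Type w} (r : FormalComb K X) : bind r (pure K) = r := by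
  classical
  ext y
  change ∑' x, r x * (if y = x then 1 else 0) = r y
  rw [tsum_eq_single y (fun x hx => by rw [if_neg (Ne.symm hx), mul_zero]), if_pos rfl, mul_one]

variable [CompleteSpace K]

theorem bind_assoc {X : Type*} {Y : Type*} {Z : Type*} (r : FormalComb K X)
    (t : X → FormalComb K Y) (s : Y → FormalComb K Z) :
    bind (bind r t) s = bind r (fun x => bind (t x) s) := by
  ext z
  change ∑' y, (∑' x, r x * t x y) * s y z = ∑' x, r x * ∑' y, t x y * s y z
  have h2 := tendsto_double r t
  have hsum : Summable fun p : X × Y => r p.1 * t p.1 p.2 * s p.2 z :=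
    summable (tendsto_mul_right h2 _)
  have hcol : ∀ y, Summable fun x => r x * t x y := fun y =>
    summable (tendsto_mul_right r.2 _)
  have hrow : ∀ x, Summable fun y => t x y * s y z := fun x =>
    summable (tendsto_mul_right (t x).2 _)
  calc ∑' y, (∑' x, r x * t x y) * s y z
      = ∑' y, ∑' x, r x * t x y * s y z :=
        tsum_congr fun y => ((hcol y).tsum_mul_right (s y z)).symm
    _ = ∑' x, ∑' y, r x * t x y * s y z := by
        refine Summable.tsum_comm' (f := fun x y => r x * t x y * s y z) hsum ?_ ?_
        · intro x
          simpa only [mul_assoc] using (hrow x).mul_left (r x)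
        · intro y
          exact (hcol y).mul_right (s y z)
    _ = ∑' x, r x * ∑' y, t x y * s y z :=
        tsum_congr fun x => by
          simp only [mul_assoc]
          exact (hrow x).tsum_mul_left (r x)

theorem bind_add {X : Type v} {Y : Type w} (r r' : FormalComb K X) (t : X → FormalComb K Y) :
    bind (r + r') t = bind r t + bind r' t := by
  ext y
  change ∑' x, (r x + r' x) * t x y = ∑' x, r x * t x y + ∑' x, r' x * t x y
  simp only [add_mul]
  exact (summable (tendsto_mul_right r.2 _)).tsum_add (summable (tendsto_mul_right r'.2 _))

theorem bind_neg {X : Type v} {Y : Type w} (r : FormalComb K X) (t : X → FormalComb K Y) :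
    bind (-r) t = - bind r t := by
  ext y
  change ∑' x, (- r x) * t x y = - ∑' x, r x * t x y
  simp only [neg_mul]
  exact tsum_neg

theorem bind_zero {X : Type v} {Y : Type w} (t : X → FormalComb K Y) :
    bind (0 : FormalComb K X) t = 0 := by
  ext y
  change ∑' x, 0 * t x y = 0
  simp

theorem bind_smul {X : Type v} {Y : Type w} (k : K) (r : FormalComb K X)
    (t : X → FormalComb K Y) : bind (k • r) t = k • bind r t := by
  ext y
  change ∑' x, k * r x * t x y = k * ∑' x, r x * t x y
  simp only [mul_assoc]
  exact (summable (tendsto_mul_right r.2 _)).tsum_mul_left k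

theorem map_pure {X : Type v} {Y : Type w} (f : X → Y) (x : X) :
    map f (pure K x) = pure K (f x) := by
  rw [map_eq_bind, pure_bind]

theorem map_id {X : Type w} (r : FormalComb K X) : map (fun x => x) r = r := by
  rw [map_eq_bind, bind_pure]

theorem map_map {X Y Z : Type*} (f : X → Y) (g : Y → Z) (r : FormalComb K X) :
    map g (map f r) = map (fun x => g (f x)) r := by
  simp only [map_eq_bind, bind_assoc, pure_bind]

theorem join_pure {X : Type w} (r : FormalComb K X) : join (pure K r) = r := by
  rw [join_eq_bind, pure_bind]; rfl

theorem join_map_pure {X : Type w} (r : FormalComb K X) : join (map (pure K) r) = r := by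
  rw [join_eq_bind, map_eq_bind, bind_assoc]
  simp only [pure_bind, id]
  exact bind_pure r

theorem join_map_map {X : Type v} {Y : Type w} (f : X → Y) (r : FormalComb K (FormalComb K X)) :
    join (map (map f) r) = map f (join r) := by
  simp only [join_eq_bind, map_eq_bind, bind_assoc, pure_bind, id]

theorem join_map_join {X : Type w} (r : FormalComb K (FormalComb K (FormalComb K X))) :
    join (map join r) = join (join r) := by
  simp only [join_eq_bind, map_eq_bind, bind_assoc, pure_bind, id]

end Infinite

end FormalComb

section Contramodules

variable (K : Type u) [Ring K] [UniformSpace K] [IsUniformAddGroup K] [IsTopologicalRing K]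
  [CompleteSpace K] [T2Space K] [IsLinearTopology Kᵐᵒᵖ K]

/-- The monad `X ↦ K[[X]]` on the category of sets. -/
def contraMonad : Monad (Type (max u v)) where
  obj X := FormalComb K X
  map f := ↾(FormalComb.map (K := K) f)
  map_id X := by
    refine ConcreteCategory.hom_ext _ _ fun r => ?_
    exact FormalComb.map_id r
  map_comp f g := by
    refine ConcreteCategory.hom_ext _ _ fun r => ?_
    exact (FormalComb.map_map f g r).symm
  η :=
    { app := fun X => ↾(fun x : X => FormalComb.pure K x)
      naturality := fun X Y f => by
        refine ConcreteCategory.hom_ext _ _ fun x => ?_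
        exact (FormalComb.map_pure f x).symm }
  μ :=
    { app := fun X => ↾(fun r : FormalComb K (FormalComb K X) => FormalComb.join r)
      naturality := fun X Y f => by
        refine ConcreteCategory.hom_ext _ _ fun r => ?_
        exact FormalComb.join_map_map f r }
  assoc X := by
    refine ConcreteCategory.hom_ext _ _ fun r => ?_
    exact FormalComb.join_map_join r
  left_unit X := by
    refine ConcreteCategory.hom_ext _ _ fun r => ?_
    exact FormalComb.join_pure r
  right_unit X := by
    refine ConcreteCategory.hom_ext _ _ fun r => ?_
    exact FormalComb.join_map_pure r

/-- The category of left `K`-contramodules: modules (algebras) over the monad `X ↦ K[[X]]`. -/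
abbrev Contramodule : Type (max u v + 1) := (contraMonad.{u, v} K).Algebra

end Contramodules

namespace Contramodule

variable {K : Type u} [Ring K] [UniformSpace K] [IsUniformAddGroup K] [IsTopologicalRing K]
  [CompleteSpace K] [T2Space K] [IsLinearTopology Kᵐᵒᵖ K]

/-- The underlying set of a contramodule. -/
def Carrier (C : Contramodule.{u, v} K) : Type (max u v) := C.A

/-- The contraaction map `π : K[[C]] → C`. -/
def contraaction (C : Contramodule.{u, v} K) (r : FormalComb K C.Carrier) : C.Carrier :=
  C.a r

variable (C : Contramodule.{u, v} K)

theorem contraaction_pure (c : C.Carrier) : C.contraaction (FormalComb.pure K c) = c :=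
  ConcreteCategory.congr_hom C.unit c

theorem contraaction_join (r : FormalComb K (FormalComb K C.Carrier)) :
    C.contraaction (FormalComb.join r) = C.contraaction (FormalComb.map C.contraaction r) :=
  ConcreteCategory.congr_hom C.assoc r

/-! The operations of a `K`-module on a contramodule are the finite instances of
the contraaction: `c + d = π(1·c + 1·d)`, `0 = π(0)`, `-c = π((-1)·c)`, `k c = π(k·c)`. -/

instance : Zero C.Carrier := ⟨C.contraaction 0⟩

instance : Add C.Carrier :=
  ⟨fun c d => C.contraaction (FormalComb.pure K c + FormalComb.pure K d)⟩

instance : Neg C.Carrier := ⟨fun c => C.contraaction (-FormalComb.pure K c)⟩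

instance : SMul K C.Carrier := ⟨fun k c => C.contraaction (k • FormalComb.pure K c)⟩

theorem contraaction_zero : C.contraaction 0 = 0 := rfl

theorem contraaction_add (r t : FormalComb K C.Carrier) :
    C.contraaction (r + t) = C.contraaction r + C.contraaction t := by
  have h := C.contraaction_join (FormalComb.pure K r + FormalComb.pure K t)
  simp only [FormalComb.join_eq_bind, FormalComb.map_eq_bind, FormalComb.bind_add,
    FormalComb.pure_bind, id] at h
  exact h

theorem contraaction_neg (r : FormalComb K C.Carrier) :
    C.contraaction (-r) = - C.contraaction r := by
  have h := C.contraaction_join (-FormalComb.pure K r)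
  simp only [FormalComb.join_eq_bind, FormalComb.map_eq_bind, FormalComb.bind_neg,
    FormalComb.pure_bind, id] at h
  exact h

theorem contraaction_smul (k : K) (r : FormalComb K C.Carrier) :
    C.contraaction (k • r) = k • C.contraaction r := by
  have h := C.contraaction_join (k • FormalComb.pure K r)
  simp only [FormalComb.join_eq_bind, FormalComb.map_eq_bind, FormalComb.bind_smul,
    FormalComb.pure_bind, id] at h
  exact h

theorem exists_rep (c : C.Carrier) : ∃ r : FormalComb K C.Carrier, C.contraaction r = c :=
  ⟨_, C.contraaction_pure c⟩

instance : AddCommGroup C.Carrier where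
  add_assoc a b c := by
    obtain ⟨a, rfl⟩ := C.exists_rep a
    obtain ⟨b, rfl⟩ := C.exists_rep b
    obtain ⟨c, rfl⟩ := C.exists_rep c
    simp only [← contraaction_add]
    congr 1
    ext x
    simp [add_assoc]
  zero_add a := by
    obtain ⟨a, rfl⟩ := C.exists_rep a
    rw [← contraaction_zero, ← contraaction_add]
    congr 1
    ext x
    simp
  add_zero a := by
    obtain ⟨a, rfl⟩ := C.exists_rep a
    rw [← contraaction_zero, ← contraaction_add]
    congr 1
    ext x
    simp
  add_comm a b := by
    obtain ⟨a, rfl⟩ := C.exists_rep a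
    obtain ⟨b, rfl⟩ := C.exists_rep b
    simp only [← contraaction_add]
    congr 1
    ext x
    simp [add_comm]
  neg_add_cancel a := by
    obtain ⟨a, rfl⟩ := C.exists_rep a
    rw [← contraaction_neg, ← contraaction_add, ← contraaction_zero]
    congr 1
    ext x
    simp
  nsmul := nsmulRec
  zsmul := zsmulRec

instance : Module K C.Carrier where
  one_smul a := by
    obtain ⟨a, rfl⟩ := C.exists_rep a
    rw [← contraaction_smul]
    congr 1
    ext x
    simp
  mul_smul k l a := by
    obtain ⟨a, rfl⟩ := C.exists_rep a
    simp only [← contraaction_smul]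
    congr 1
    ext x
    simp [mul_assoc]
  smul_zero k := by
    rw [← contraaction_zero, ← contraaction_smul]
    congr 1
    ext x
    simp
  smul_add k a b := by
    obtain ⟨a, rfl⟩ := C.exists_rep a
    obtain ⟨b, rfl⟩ := C.exists_rep b
    simp only [← contraaction_smul, ← contraaction_add]
    congr 1
    ext x
    simp [mul_add]
  add_smul k l a := by
    obtain ⟨a, rfl⟩ := C.exists_rep a
    simp only [← contraaction_smul, ← contraaction_add]
    congr 1
    ext x
    simp [add_mul]
  zero_smul a := by
    obtain ⟨a, rfl⟩ := C.exists_rep a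
    rw [← contraaction_zero, ← contraaction_smul]
    congr 1
    ext x
    simp

variable {C}
variable {D : Contramodule.{u, v} K}

/-- The map of underlying sets of a morphism of contramodules. -/
def homFun (f : C ⟶ D) : C.Carrier → D.Carrier := fun c => f.f c

theorem homFun_contraaction (f : C ⟶ D) (r : FormalComb K C.Carrier) :
    homFun f (C.contraaction r) = D.contraaction (FormalComb.map (homFun f) r) :=
  (ConcreteCategory.congr_hom f.h r).symm

/-- A morphism of contramodules is a morphism of the underlying modules. -/
def homLinear (f : C ⟶ D) : C.Carrier →ₗ[K] D.Carrier where
  toFun := homFun f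
  map_add' c d := by
    change homFun f (C.contraaction _) = D.contraaction _
    rw [homFun_contraaction, FormalComb.map_eq_bind, FormalComb.bind_add, FormalComb.pure_bind,
      FormalComb.pure_bind]
  map_smul' k c := by
    change homFun f (C.contraaction _) = D.contraaction _
    rw [homFun_contraaction, FormalComb.map_eq_bind, FormalComb.bind_smul, FormalComb.pure_bind]
    rfl

variable (K) in
/-- The forgetful functor from left `K`-contramodules to left `K`-modules. -/
def toModule : Contramodule.{u, v} K ⥤ ModuleCat.{max u v} K where
  obj C := ModuleCat.of K C.Carrier
  map f := ModuleCat.ofHom (homLinear f)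

/-- The forgetful functor from left `K`-contramodules to left `R`-modules defined by a ring
homomorphism `θ : R → K`: an element `r` acts on a contramodule by `c ↦ π(θ(r)·c)`. -/
def forgetful {R : Type w} [Ring R] (θ : R →+* K) :
    Contramodule.{u, v} K ⥤ ModuleCat.{max u v} R :=
  toModule K ⋙ ModuleCat.restrictScalars θ

end Contramodule

/-- A two-sided ideal viewed as a right ideal. -/
def TwoSidedIdeal.asRightIdeal {K : Type u} [Ring K] (I : TwoSidedIdeal K) :
    Submodule Kᵐᵒᵖ K where
  carrier := I
  add_mem' := I.add_mem
  zero_mem' := I.zero_mem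
  smul_mem' k x hx := I.mul_mem_right x k.unop hx

/-- The finite family `s₁, …, sₘ` of elements of the right ideal `J` strongly generates `J`: every
family `r_x` in `J` converging to zero in `K` can be written as `r_x = ∑ⱼ sⱼ r_{j,x}` for some
families `r_{j,x}` in `K` (`j = 1, …, m`), each converging to zero.

In a separated ring a family converging to zero takes any nonzero value finitely many times, so
its support is finite or has at most the cardinality of `K`; as one can discard the indices with
`r_x = 0`, no generality is lost by taking the index sets in the universe of `K`. -/
def StronglyGenerates {K : Type u} [Ring K] [TopologicalSpace K] (J : Submodule Kᵐᵒᵖ K)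
    {m : ℕ} (s : Fin m → K) : Prop :=
  (∀ j, s j ∈ J) ∧
  ∀ (X : Type u) (r : X → K), (∀ x, r x ∈ J) → Tendsto r cofinite (𝓝 0) →
    ∃ t : Fin m → X → K, (∀ j, Tendsto (t j) cofinite (𝓝 0)) ∧ ∀ x, r x = ∑ j, s j * t j x

end

/-! Faithfulness is immediate, since underlying maps are unchanged. For fullness, an `R`-linear map
`f : C → D` of contramodules has a defect `g r = f (π r) - π (map f r)` on `K[[C]]`; it is additive,
`R`-linear and zero on the generators `pure K c`, and the claim is `g = 0`. Fix a basic ideal `I`.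
Only finitely many coefficients of `r` lie outside `I`, so by density finitely many terms `θ a •
pure K x`, which `g` kills, move all of them into `I`. Strong generation then writes the result as
`∑ θ (s j) • t j`, so `g r = ∑ θ (s j) • g (t j)`. Thus every value of `g` is a combination of
values of `g` with coefficients in `I`, for arbitrarily small `I` (`eq_zero_of_map_pure_eq_zero`).
Iterating such expressions along a sequence of ideals shrinking to zero gives layers that fit into
one convergent combination `W`. Dropping its initial layer does not change its value in `D` beyond
`g r` itself, while re-expanding each term shows that the value is unchanged: a swindle forcing `g r
= 0` (`eq_zero_of_eq_contraaction`). -/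

open FormalComb in
/-- The contraaction is compatible with substitution. -/
theorem Contramodule.contraaction_bind {K : Type u} [Ring K] [UniformSpace K] [IsUniformAddGroup K]
    [IsTopologicalRing K] [CompleteSpace K] [T2Space K] [IsLinearTopology Kᵐᵒᵖ K]
    (D : Contramodule.{u, v} K) {Y : Type*} (r : FormalComb K Y)
    (t : Y → FormalComb K D.Carrier) :
    D.contraaction (bind r t) = D.contraaction (map (fun y => D.contraaction (t y)) r) := by
  -- Substitution is associativity of the contraaction at `map t r`, whose `join` is `bind r t`.
  have h := D.contraaction_join (map t r)
  rw [FormalComb.map_map] at h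
  rw [← h, join_eq_bind, map_eq_bind, FormalComb.bind_assoc]
  simp only [FormalComb.pure_bind, id]

/-! ### Formal combinations: additive structure, approximation by `R`-coefficients, countable
supports. -/

namespace FormalComb

section Algebraic

variable {K : Type u} [Ring K] [TopologicalSpace K] [IsTopologicalRing K] {X : Type w}

instance : AddCommGroup (FormalComb K X) where
  add_assoc a b c := by ext x; simp [add_assoc]
  zero_add a := by ext x; simp
  add_zero a := by ext x; simp
  add_comm a b := by ext x; simp [add_comm]
  neg_add_cancel a := by ext x; simp
  nsmul := nsmulRec
  zsmul := zsmulRec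

/-- The coefficient at `x`, as an additive map. -/
def coeffHom (x : X) : FormalComb K X →+ K where
  toFun r := r x
  map_zero' := rfl
  map_add' _ _ := rfl

theorem sum_apply {ι : Type*} (s : Finset ι) (r : ι → FormalComb K X) (x : X) :
    (∑ i ∈ s, r i) x = ∑ i ∈ s, r i x :=
  map_sum (coeffHom x) r s

open Classical in
theorem pure_apply {K : Type u} [Ring K] [TopologicalSpace K] {X : Type w} (x y : X) :
    pure K x y = if y = x then 1 else 0 := rfl

end Algebraic

section Infinite

variable {K : Type u} [Ring K] [UniformSpace K] [IsUniformAddGroup K] [IsTopologicalRing K]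
  [IsLinearTopology Kᵐᵒᵖ K] [CompleteSpace K] [T2Space K]

theorem map_add {X : Type v} {Y : Type w} (f : X → Y) (r t : FormalComb K X) :
    map f (r + t) = map f r + map f t := by
  simp only [map_eq_bind, bind_add]

theorem map_smul {X : Type v} {Y : Type w} (f : X → Y) (k : K) (r : FormalComb K X) :
    map f (k • r) = k • map f r := by
  simp only [map_eq_bind, bind_smul]

end Infinite

/-- Density: an additive map vanishing on the multiples of the elements of `X` by the
coefficients from `R` takes all its values on the combinations with coefficients in a given
open ideal. -/
theorem exists_forall_mem_of_denseRange {K : Type u} [Ring K] [TopologicalSpace K]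
    [IsTopologicalRing K] {R : Type*} [Ring R] {θ : R →+* K} (hθ : DenseRange θ) (I : TwoSidedIdeal K)
    (hI : IsOpen (I : Set K)) {X M : Type*} [AddCommGroup M] (g : FormalComb K X →+ M)
    (hg : ∀ a x, g (θ a • pure K x) = 0) (r : FormalComb K X) :
    ∃ r', (∀ x, r' x ∈ I) ∧ g r' = g r := by
  classical
  have hfin : {x | r x ∉ I}.Finite := r.tendsto (hI.mem_nhds I.zero_mem)
  have key : ∀ S : Finset X, ∃ r', (∀ x, x ∈ S ∨ r x ∈ I → r' x ∈ I) ∧ g r' = g r := by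
    intro S
    induction S using Finset.induction_on with
    | empty => exact ⟨r, by simp, rfl⟩
    | insert y S hy ih =>
      obtain ⟨r', hr', hgr⟩ := ih
      -- The translate `-r' y + I` is open and nonempty, so it meets the image of `θ`; adding `θ a`
      -- at `y` puts that coefficient into `I` and leaves the others alone.
      obtain ⟨a, ha⟩ := hθ.exists_mem_open
        (hI.preimage (continuous_const.add continuous_id : Continuous fun b : K => r' y + b))
        ⟨-r' y, by simp⟩
      refine ⟨r' + θ a • pure K y, fun x hx => ?_, by rw [_root_.map_add, hg, add_zero, hgr]⟩
      rw [add_apply, smul_apply, pure_apply]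
      by_cases hxy : x = y
      · subst hxy
        simpa using ha
      · rw [if_neg hxy, mul_zero, add_zero]
        exact hr' x (by simpa [hxy] using hx)
  obtain ⟨r', hr', h⟩ := key hfin.toFinset
  exact ⟨r', fun x => hr' x (by simpa using em' _), h⟩

/-- A family converging to zero in a separated first countable ring has countable support. -/
theorem countable_support {K : Type u} [Ring K] [TopologicalSpace K] [T1Space K]
    [FirstCountableTopology K] {X : Type w} (r : FormalComb K X) :
    {x | r x ≠ 0}.Countable := by
  obtain ⟨U, hU⟩ := (𝓝 (0 : K)).exists_antitone_basis
  refine (Set.countable_iUnion fun n =>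
    (r.tendsto (hU.toHasBasis.mem_of_mem (i := n) trivial)).countable).mono ?_
  intro x hx
  obtain ⟨n, -, hn⟩ := hU.toHasBasis.mem_iff.1 (isOpen_compl_singleton.mem_nhds hx.symm)
  exact Set.mem_iUnion.2 ⟨n, fun h => hn h rfl⟩

end FormalComb

/-- Strong generation for families indexed by a set of an arbitrary universe. -/
theorem StronglyGenerates.exists_formalComb {K : Type u} [Ring K] [TopologicalSpace K]
    [IsTopologicalRing K] [T1Space K] [FirstCountableTopology K] {J : Submodule Kᵐᵒᵖ K} {m : ℕ}
    {s : Fin m → K} (h : StronglyGenerates J s) {X : Type w} (r : FormalComb K X)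
    (hr : ∀ x, r x ∈ J) : ∃ t : Fin m → FormalComb K X, r = ∑ j, s j • t j := by
  classical
  -- A countable support is small in every universe, so it can be replaced by an index type in the
  -- universe of `K`, as `StronglyGenerates` requires.
  have := r.countable_support.to_subtype
  let e := equivShrink.{u} {x | r x ≠ 0}
  have hinj : Function.Injective fun y => ((e.symm y : {x | r x ≠ 0}) : X) :=
    Subtype.val_injective.comp e.symm.injective
  obtain ⟨t, ht, hrt⟩ := h.2 _ (fun y => r (e.symm y)) (fun y => hr _)
    (r.tendsto.comp hinj.tendsto_cofinite)
  -- Extension by zero off the support keeps convergence to zero.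
  refine ⟨fun j => ⟨fun x => if hx : r x ≠ 0 then t j (e ⟨x, hx⟩) else 0, ?_⟩, ?_⟩
  · intro U hU
    refine Set.Finite.subset ((ht j hU).image fun y => ((e.symm y : {x | r x ≠ 0}) : X)) ?_
    intro x hx
    by_cases h0 : r x ≠ 0
    · refine ⟨e ⟨x, h0⟩, ?_, by simp⟩
      intro hy
      exact hx (by simpa only [Set.mem_preimage, dif_pos h0] using hy)
    · exact absurd (by simpa only [Set.mem_preimage, dif_neg h0] using mem_of_mem_nhds hU) hx
  · ext x
    rw [FormalComb.sum_apply]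
    by_cases h0 : r x ≠ 0
    · simpa [h0] using hrt (e ⟨x, h0⟩)
    · simp only [FormalComb.smul_apply, dif_neg h0, mul_zero, Finset.sum_const_zero]
      exact not_not.1 h0

/-! ### Nakayama-type vanishing for maps into contramodules. -/

namespace Contramodule

open FormalComb

variable {K : Type u} [Ring K] [UniformSpace K] [IsUniformAddGroup K] [IsTopologicalRing K]
  [CompleteSpace K] [T2Space K] [IsLinearTopology Kᵐᵒᵖ K]

/-- A form of the contramodule Nakayama lemma: a map `g` to a contramodule vanishes if each of its
values can be expressed through its values with coefficients in each of a sequence of ideals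
converging to zero. -/
theorem eq_zero_of_eq_contraaction (D : Contramodule.{u, v} K) {Y : Type*} (g : Y → D.Carrier)
    (I : ℕ → TwoSidedIdeal K) (hopen : ∀ n, IsOpen (I n : Set K))
    (hI : ∀ U ∈ 𝓝 (0 : K), ∀ᶠ n in atTop, (I n : Set K) ⊆ U)
    (φ : ℕ → Y → FormalComb K Y) (hφ : ∀ n y x, φ n y x ∈ I n)
    (hg : ∀ n y, D.contraaction (map g (φ n y)) = g y) (y : Y) : g y = 0 := by
  classical
  -- The layer `z n` is the `n`-fold expansion of `y`, with step `n + 1` using the ideal `I (n +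
  -- 1)`; the initial layer is `y` itself.
  let z : ℕ → FormalComb K Y := fun n =>
    Nat.rec (pure K y) (fun n r => bind r (φ (n + 1))) n
  -- Two-sidedness matters here: the earlier coefficients multiply those of `φ` on the left.
  have hz : ∀ n x, z (n + 1) x ∈ I (n + 1) := fun n x =>
    tsum_mem (J := (I (n + 1)).asRightIdeal) (hopen _) fun x' =>
      (I (n + 1)).mul_mem_left _ _ (hφ _ _ _)
  -- All layers at once. Those beyond some `N` lie entirely in a given neighborhood, and each of the
  -- remaining finitely many converges to zero by itself.
  let W : FormalComb K (ℕ × Y) := ⟨fun p => z p.1 p.2, by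
    intro U hU
    obtain ⟨N, hN⟩ := eventually_atTop.1 (hI U hU)
    refine Set.Finite.subset ((Set.finite_Iic N).biUnion fun n _ =>
      Set.Finite.image (Prod.mk n) ((z n).tendsto hU)) ?_
    rintro ⟨n, x⟩ hx
    refine Set.mem_biUnion (x := n) ?_ ⟨x, hx, rfl⟩
    by_contra hn
    obtain ⟨k, rfl⟩ := Nat.exists_eq_succ_of_ne_zero (n := n) (by rintro rfl; simp at hn)
    exact hx (hN _ (by simp at hn; omega) (hz k x))⟩
  -- `Φ` expands a term of layer `n` into layer `n + 1`, so substituting it shifts `W` by one layer.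
  let Φ : ℕ × Y → FormalComb K (ℕ × Y) := fun p => map (Prod.mk (p.1 + 1)) (φ (p.1 + 1) p.2)
  let g' : ℕ × Y → D.Carrier := fun p => g p.2
  have hΦ : ∀ n x m x', Φ (n, x) (m, x') = if m = n + 1 then φ (n + 1) x x' else 0 := by
    intro n x m x'
    change ∑' q : {q : Y // (n + 1, q) = (m, x')}, φ (n + 1) x q.1 = _
    split_ifs with h
    · subst h
      rw [tsum_eq_single (⟨x', rfl⟩ : {q : Y // (n + 1, q) = (n + 1, x')})]
      rintro ⟨q, hq⟩ hne
      exact absurd (Subtype.ext (Prod.ext_iff.1 hq).2) hne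
    · have : IsEmpty {q : Y // (n + 1, q) = (m, x')} :=
        ⟨fun q => h (Prod.ext_iff.1 q.2).1.symm⟩
      exact tsum_empty
  have hW : W = pure K (0, y) + bind W Φ := by
    ext ⟨m, x⟩
    change z m x = pure K (0, y) (m, x) + ∑' p : ℕ × Y, z p.1 p.2 * Φ p (m, x)
    cases m with
    | zero =>
      have h0 : ∀ p : ℕ × Y, z p.1 p.2 * Φ p (0, x) = 0 := fun p => by simp [hΦ p.1 p.2]
      rw [tsum_congr h0, tsum_zero, add_zero]
      change pure K y x = _
      simp [pure_apply]
    | succ k =>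
      have hinj : Function.Injective (Prod.mk k : Y → ℕ × Y) := Prod.mk_right_injective k
      -- Only layer `k` contributes to layer `k + 1`, so the sum restricts to that slice.
      rw [pure_apply, if_neg (by simp), zero_add, ← hinj.tsum_eq]
      · simp only [hΦ, if_true]
        rfl
      · rintro ⟨n, x'⟩ hp
        by_cases hn : k = n
        · exact ⟨x', by rw [hn]⟩
        · exact absurd (by simp [hΦ, hn]) hp
  -- By `hg`, expanding a term does not change its value under `g'`, hence neither does the shift;
  -- with `hW` this leaves `g y` to cancel.
  have hbind : D.contraaction (map g' (bind W Φ)) = D.contraaction (map g' W) := by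
    rw [map_eq_bind g' (bind W Φ), FormalComb.bind_assoc, contraaction_bind]
    congr 2
    funext p
    rw [← map_eq_bind, FormalComb.map_map]
    exact hg _ _
  have hsum : D.contraaction (map g' W) = g y + D.contraaction (map g' W) := by
    conv_lhs => rw [hW]
    rw [FormalComb.map_add, contraaction_add, hbind, FormalComb.map_pure, contraaction_pure]
  simpa using hsum

variable {R : Type w} [Ring R] {θ : R →+* K}

/-- An `R`-linear map from a free contramodule to a contramodule vanishing on the free generators
is zero. -/
theorem eq_zero_of_map_pure_eq_zero (hθ : DenseRange θ)
    (B : Set (TwoSidedIdeal K)) (hcount : B.Countable)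
    (hopen : ∀ I ∈ B, IsOpen (I : Set K))
    (hbase : (𝓝 (0 : K)).HasBasis (fun I : TwoSidedIdeal K => I ∈ B) (fun I => (I : Set K)))
    (hgen : ∀ I ∈ B, ∃ (m : ℕ) (s : Fin m → R),
      StronglyGenerates I.asRightIdeal (fun j => θ (s j)))
    (D : Contramodule.{u, v} K) {X : Type*} (g : FormalComb K X →+ D.Carrier)
    (hsmul : ∀ a r, g (θ a • r) = θ a • g r) (hpure : ∀ x, g (pure K x) = 0)
    (r : FormalComb K X) : g r = 0 := by
  have hcg : (𝓝 (0 : K)).IsCountablyGenerated := ⟨⟨(fun I : TwoSidedIdeal K => (I : Set K)) '' B,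
    hcount.image _, by
      refine hbase.eq_biInf.trans ?_
      rw [generate_eq_biInf, iInf_image]⟩⟩
  have : FirstCountableTopology K := by
    have := IsUniformAddGroup.uniformity_countably_generated (α := K)
    exact UniformSpace.firstCountableTopology K
  obtain ⟨U, hU⟩ := (𝓝 (0 : K)).exists_antitone_basis
  choose I hIB hIU using fun n => hbase.mem_iff.1 (hU.toHasBasis.mem_of_mem (i := n) trivial)
  have hstep : ∀ n (r : FormalComb K X), ∃ φ : FormalComb K (FormalComb K X),
      (∀ x, φ x ∈ I n) ∧ D.contraaction (map g φ) = g r := by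
    intro n r
    obtain ⟨m, s, hs⟩ := hgen (I n) (hIB n)
    obtain ⟨r', hr', hgr⟩ := exists_forall_mem_of_denseRange hθ (I n) (hopen _ (hIB n)) g
      (fun a x => by rw [hsmul, hpure, smul_zero]) r
    obtain ⟨t, rfl⟩ := hs.exists_formalComb r' hr'
    -- The `t j` serve as formal generators; the coefficients lie in `I n` because the `θ (s j)` do.
    refine ⟨∑ j, θ (s j) • pure K (t j), fun x => ?_, ?_⟩
    · rw [FormalComb.sum_apply]
      exact (I n).asRightIdeal.sum_mem fun j _ => FormalComb.mul_mem_right (hs.1 j) _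
    · let G : FormalComb K (FormalComb K X) →+ D.Carrier :=
        AddMonoidHom.mk' (fun φ => D.contraaction (map g φ)) fun a b => by
          rw [FormalComb.map_add, contraaction_add]
      change G _ = _
      rw [← hgr, map_sum, map_sum]
      refine Finset.sum_congr rfl fun j _ => ?_
      change D.contraaction (map g _) = _
      rw [FormalComb.map_smul, contraaction_smul, FormalComb.map_pure, contraaction_pure, hsmul]
  choose φ hφ hgφ using hstep
  exact D.eq_zero_of_eq_contraaction g I (fun n => hopen _ (hIB n))
    (fun V hV => by
      obtain ⟨N, -, hN⟩ := hU.toHasBasis.mem_iff.1 hV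
      filter_upwards [eventually_ge_atTop N] with n hn
      exact (hIU n).trans ((hU.antitone hn).trans hN))
    φ hφ hgφ r

/-- The morphism of contramodules with a given underlying map. -/
def homMk {C D : Contramodule.{u, v} K} (f : C.Carrier → D.Carrier)
    (hf : ∀ r, f (C.contraaction r) = D.contraaction (map f r)) : C ⟶ D where
  f := ↾(f : C.A → D.A)
  h := by
    refine ConcreteCategory.hom_ext _ _ fun r => ?_
    exact (hf r).symm

end Contramodule

theorem mainTheorem4 {K : Type u} [Ring K] [UniformSpace K] [IsUniformAddGroup K]
    [IsTopologicalRing K] [CompleteSpace K] [T2Space K] [IsLinearTopology Kᵐᵒᵖ K]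
    {R : Type w} [Ring R] (θ : R →+* K) (hθ : DenseRange θ)
    (B : Set (TwoSidedIdeal K)) (hcount : B.Countable)
    (hopen : ∀ I ∈ B, IsOpen (I : Set K))
    (hbase : (𝓝 (0 : K)).HasBasis (fun I : TwoSidedIdeal K => I ∈ B) (fun I => (I : Set K)))
    (hgen : ∀ I ∈ B, ∃ (m : ℕ) (s : Fin m → R),
      StronglyGenerates I.asRightIdeal (fun j => θ (s j))) :
    (Contramodule.forgetful.{u, v, w} θ).Full ∧ (Contramodule.forgetful.{u, v, w} θ).Faithful := by
  refine ⟨⟨fun {C D} F => ?_⟩, ⟨fun {C D} f f' h => ?_⟩⟩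
  · let f : C.Carrier → D.Carrier := fun c => F.hom c
    have hadd : ∀ c d, f (c + d) = f c + f d := fun c d => F.hom.map_add c d
    have hsmul : ∀ (a : R) c, f (θ a • c) = θ a • f c := fun a c => F.hom.map_smul a c
    -- The defect of `f` as a contramodule morphism.
    let g : FormalComb K C.Carrier →+ D.Carrier :=
      AddMonoidHom.mk' (fun r => f (C.contraaction r) - D.contraaction (FormalComb.map f r))
        fun r t => by
          rw [FormalComb.map_add, Contramodule.contraaction_add, Contramodule.contraaction_add,
            hadd, add_sub_add_comm]
    have hg := Contramodule.eq_zero_of_map_pure_eq_zero hθ B hcount hopen hbase hgen D g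
      (fun a r => by
        change f _ - _ = θ a • (f _ - _)
        rw [FormalComb.map_smul, Contramodule.contraaction_smul, Contramodule.contraaction_smul,
          hsmul, smul_sub])
      (fun c => by
        change f _ - _ = 0
        rw [FormalComb.map_pure, Contramodule.contraaction_pure, Contramodule.contraaction_pure,
          sub_self])
    refine ⟨Contramodule.homMk f fun r => sub_eq_zero.1 (hg r), ?_⟩
    ext c
    rfl
  · ext c
    exact congrArg (fun φ => φ.hom c) h
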